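/- **Theorem 3.2.** Let $\mathcal Z,\mathcal W$ be measurable spaces, $\nu$ a probability measure on $\mathcal W$, $\psi:\mathcal Z\times\mathcal W\to\mathbb R$ measurable, and let $(Z,Y)$ be a random pair in $\mathcal Z\times\mathbb R$ with $\mathbb E[Y^2]<\infty$. Let $n,d\ge 1$, $0<\rho<1$ and $L,\ell,\kappa>0$. Let $W,W_1,\dots,W_d$ be i.i.d. with law $\nu$, let $(Z_i,Y_i)_{i\le n}$ be i.i.d. copies of $(Z,Y)$, and let $P,P_1,\dots,P_n\in\{0,1\}^d$ be i.i.d. masks whose entries are independent Bernoulli($\rho$) (value $1$ = observed); weights, pairs and masks are independent of each other. Assume that * $\psi(Z,\cdot)\in L^2(\nu)$ a.s.; $\ell^2\le\mathbb E[\psi(Z,W)^2\mid W]\le L^2$ a.s.; $|\psi(Z,W)|^2\le\kappa L^2$ a.s., with $W$ independent of $Z$; * (well-specified model) the Bayes predictor $f^\star(z)=\mathbb E[Y\mid Z=z]$ belongs to the class $\mathcal F_\nu^{(\infty)}$ of functions of the form $f(z)=\int\alpha(w)\psi(z,w)\,d\nu(w)$ for all $z\in\mathcal Z$, with $\alpha\in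 L^2(\nu)$. Let $\|f\|_\nu^2$ be the infimum of $\int\alpha^2\,d\nu$ over all such $\alpha$ representing $f$. Let $R^\star(\infty)=\inf_{f\in\mathcal F_\nu^{(\infty)}}\mathbb E[(Y-f(Z))^2]$. Put $X_{i}=(\psi(Z_i,W_j))_{j\le d}$, $\tilde X_i=P_i\odot X_i$ (imputation by zero), likewise $\tilde X=P\odot(\psi(Z,W_j))_{j\le d}$ for an independent test triple $(Z,Y,P)$, and $R_{\rm imp}(\theta)=\mathbb E[(Y-\tilde X^\top\theta)^2\mid W_1,\dots,W_d]$. For a step size $\gamma>0$, let $\theta_0=0$, $\theta_t=(I-\gamma\tilde X_t\tilde X_t^\top)\theta_{t-1}+\gamma Y_t\tilde X_t$ for $1\le t\le n$, and $\bar\theta=\frac1{n+1}\sum_{t=1}^n\theta_t$. There is a universal constant $C>0$ such that the following holds in every such setting. 1. With $\gamma=\dfrac1{\kappa L^2d\sqrt n}$, the variable $R_{\rm imp}(\bar\theta)-R^\star(\infty)$ is integrable and $$\mathbb E\big[R_{\rm imp}(\bar\theta)-R^\star(\infty)\big]\le C\left(\frac{L^2}{\rho d}\|f^\star\|_\nu^2+\kappa\,\frac{L^2}{\ell^2}\,\frac{L^2}{\rho^2(1-\rho)\sqrt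 n}\|f^\star\|_\nu^2+\frac{\mathbb E[Y^2]}{\sqrt n}\right).$$ 2. With $\gamma=\dfrac1{\kappa d\sqrt n}$, if $L^2\le\sqrt n$, the variable $R_{\rm imp}(\bar\theta)-R^\star(\infty)$ is integrable and $$\mathbb E\big[R_{\rm imp}(\bar\theta)-R^\star(\infty)\big]\le C\left(\frac{L^2}{\rho d}\|f^\star\|_\nu^2+\frac{\kappa}{\ell^2}\,\frac{L^2}{\rho^2(1-\rho)\sqrt n}\|f^\star\|_\nu^2+\frac{L^2\,\mathbb E[Y^2]}{\sqrt n}\right).$$ For normalized features ($L=1$) the two parts coincide. -/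

import Mathlib

open MeasureTheory ProbabilityTheory

/-! Notation used below: `ψ : 𝒵 → 𝒲 → ℝ` is the feature map, `ν` the law of a weight `W`,
`μ` the joint law of the pair `(Z, Y)` of a latent variable and its output,
`ρ` the probability that an entry is observed. -/

/-- The random feature vector `X = (ψ(z, w_1), …, ψ(z, w_d))`. -/
def featureVec {𝒵 𝒲 : Type*} (ψ : 𝒵 → 𝒲 → ℝ) {d : ℕ} (z : 𝒵) (w : Fin d → 𝒲) : Fin d → ℝ :=
  fun j => ψ z (w j)

/-- The zero-imputed input `X̃ = P ⊙ X`, for a mask `p` with entries in `{0, 1}`. -/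
def zeroImpute {d : ℕ} (p x : Fin d → ℝ) : Fin d → ℝ :=
  fun j => p j * x j

/-- The law of the mask: `d` independent Bernoulli(`ρ`) entries with values in `{0, 1} ⊆ ℝ`. -/
noncomputable def maskLaw (ρ : unitInterval) (d : ℕ) : Measure (Fin d → ℝ) :=
  Measure.pi fun _ => bernoulliMeasure (1 : ℝ) 0 ρ

/-- `f(z) = ∫ α(w) ψ(z, w) dν(w)` for every `z`, with `α` square integrable. -/
def Represents {𝒵 𝒲 : Type*} [MeasurableSpace 𝒲] (ψ : 𝒵 → 𝒲 → ℝ) (ν : Measure 𝒲)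
    (α : 𝒲 → ℝ) (f : 𝒵 → ℝ) : Prop :=
  MemLp α 2 ν ∧ ∀ z, Integrable (fun w => α w * ψ z w) ν ∧ f z = ∫ w, α w * ψ z w ∂ν

/-- The class of infinitely wide random feature predictors. -/
def featureClass {𝒵 𝒲 : Type*} [MeasurableSpace 𝒲] (ψ : 𝒵 → 𝒲 → ℝ) (ν : Measure 𝒲) :
    Set (𝒵 → ℝ) :=
  {f | ∃ α, Represents ψ ν α f}

/-- The squared norm `‖f‖_ν²`: the infimum of `∫ α² dν` over all representations `α` of `f`. -/
noncomputable def nuNormSq {𝒵 𝒲 : Type*} [MeasurableSpace 𝒲] (ψ : 𝒵 → 𝒲 → ℝ) (ν : Measure 𝒲)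
    (f : 𝒵 → ℝ) : ℝ :=
  sInf ((fun α : 𝒲 → ℝ => ∫ w, α w ^ 2 ∂ν) '' {α | Represents ψ ν α f})

/-- The quadratic risk `E[(Y - f(Z))²]`. -/
noncomputable def latentRisk {𝒵 : Type*} [MeasurableSpace 𝒵] (μ : Measure (𝒵 × ℝ))
    (f : 𝒵 → ℝ) : ℝ :=
  ∫ q, (q.2 - f q.1) ^ 2 ∂μ

/-- `R⋆(∞)`: the smallest risk over the class of infinitely wide random feature predictors. -/
noncomputable def bestRiskInfty {𝒵 𝒲 : Type*} [MeasurableSpace 𝒵] [MeasurableSpace 𝒲]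
    (ψ : 𝒵 → 𝒲 → ℝ) (ν : Measure 𝒲) (μ : Measure (𝒵 × ℝ)) : ℝ :=
  sInf (latentRisk μ '' featureClass ψ ν)

/-- `f` is a version of the regression function: `f(Z) = E[Y | Z]` almost surely. -/
def IsBayesPredictor {𝒵 : Type*} [MeasurableSpace 𝒵] (μ : Measure (𝒵 × ℝ)) (f : 𝒵 → ℝ) : Prop :=
  (fun q : 𝒵 × ℝ => f q.1) =ᵐ[μ]
    condExp (MeasurableSpace.comap Prod.fst inferInstance) μ (fun q : 𝒵 × ℝ => q.2)

/-- `R_imp(θ) = E[(Y - X̃ᵀ θ)² | W_1 = w_1, …, W_d = w_d]`, the expectation being over an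
independent test triple `(Z, Y, P)`. -/
noncomputable def impRisk {𝒵 𝒲 : Type*} [MeasurableSpace 𝒵] (ψ : 𝒵 → 𝒲 → ℝ)
    (μ : Measure (𝒵 × ℝ)) (ρ : unitInterval) {d : ℕ} (w : Fin d → 𝒲) (θ : Fin d → ℝ) : ℝ :=
  ∫ q, (q.1.2 - zeroImpute q.2 (featureVec ψ q.1.1 w) ⬝ᵥ θ) ^ 2 ∂(μ.prod (maskLaw ρ d))

/-- The SGD iterates `θ_0 = 0`, `θ_t = (I - γ x_t x_tᵀ) θ_{t-1} + γ y_t x_t` for `1 ≤ t ≤ n`;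
the sample numbered `t` is stored at index `t - 1`. -/
noncomputable def sgdIterate {n d : ℕ} (γ : ℝ) (x : Fin n → Fin d → ℝ) (y : Fin n → ℝ)
    (t : Fin (n + 1)) : Fin d → ℝ :=
  Fin.induction (motive := fun _ => Fin d → ℝ) 0
    (fun i θ => (1 - γ • Matrix.vecMulVec (x i) (x i)).mulVec θ + (γ * y i) • x i) t

/-- The Polyak-Ruppert average `(n + 1)⁻¹ (θ_1 + … + θ_n)`. -/
noncomputable def sgdAverage {n d : ℕ} (γ : ℝ) (x : Fin n → Fin d → ℝ) (y : Fin n → ℝ) :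
    Fin d → ℝ :=
  ((n : ℝ) + 1)⁻¹ • ∑ i : Fin n, sgdIterate γ x y i.succ

/-- The random variables of the model: `W_1, …, W_d` are i.i.d. with law `ν`, the pairs
`(Z_i, Y_i)` are i.i.d. with law `μ`, the masks `P_i` are i.i.d. with independent
Bernoulli(`ρ`) entries, and weights, pairs and masks are independent of each other.
All of this is one statement: their joint law is the product law. -/
def IsMCARSample {Ω 𝒵 𝒲 : Type*} [MeasurableSpace Ω] [MeasurableSpace 𝒵] [MeasurableSpace 𝒲]
    (Pr : Measure Ω) (ν : Measure 𝒲) (μ : Measure (𝒵 × ℝ)) (ρ : unitInterval) {n d : ℕ}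
    (W : Fin d → Ω → 𝒲) (Z : Fin n → Ω → 𝒵) (Y : Fin n → Ω → ℝ) (P : Fin n → Fin d → Ω → ℝ) :
    Prop :=
  HasLaw (fun ω => ((fun j => W j ω), fun i => ((Z i ω, Y i ω), fun j => P i j ω)))
    ((Measure.pi fun _ : Fin d => ν).prod (Measure.pi fun _ : Fin n => μ.prod (maskLaw ρ d))) Pr

/-- The averaged SGD estimator run on the zero-imputed training sample, as a random vector. -/
noncomputable def sgdEstimator {Ω 𝒵 𝒲 : Type*} (ψ : 𝒵 → 𝒲 → ℝ) (γ : ℝ) {n d : ℕ}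
    (W : Fin d → Ω → 𝒲) (Z : Fin n → Ω → 𝒵) (Y : Fin n → Ω → ℝ) (P : Fin n → Fin d → Ω → ℝ)
    (ω : Ω) : Fin d → ℝ :=
  sgdAverage γ
    (fun i => zeroImpute (fun j => P i j ω) (featureVec ψ (Z i ω) fun j => W j ω))
    (fun i => Y i ω)

/-- The random excess risk `R_imp(θ̄) - R⋆(∞)` of averaged SGD with step size `γ`. -/
noncomputable def excessRisk {Ω 𝒵 𝒲 : Type*} [MeasurableSpace 𝒵] [MeasurableSpace 𝒲]
    (ψ : 𝒵 → 𝒲 → ℝ) (ν : Measure 𝒲) (μ : Measure (𝒵 × ℝ)) (ρ : unitInterval) (γ : ℝ) {n d : ℕ}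
    (W : Fin d → Ω → 𝒲) (Z : Fin n → Ω → 𝒵) (Y : Fin n → Ω → ℝ) (P : Fin n → Fin d → Ω → ℝ)
    (ω : Ω) : ℝ :=
  impRisk ψ μ ρ (fun j => W j ω) (sgdEstimator ψ γ W Z Y P ω) - bestRiskInfty ψ ν μ

/-! ### Pathwise analysis of stochastic gradient descent. -/

section SGD

variable {n d : ℕ}

/-! With the weights fixed, zero-imputed SGD is least-squares SGD on i.i.d. inputs whose squared
norm is at most `d * K`, where `K = κ * L ^ 2`. Put `q = γ * (d * K) ≤ 1`. Expanding the squared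
distance to a comparator `θ` and telescoping gives a deterministic regret bound: the cumulative
squared loss is at most `2 ‖θ‖² / γ` plus `1 + 3 * q` times that of `θ`. Neither invertibility of
the covariance nor a noise model enters. The expected risk of the `t`-th iterate is its expected
loss on the next sample of a run of length `n + 1`, so convexity turns regret into a risk bound for
the average (`lintegral_risk_sgdAverage_le`).

The comparator may depend on the weights: `θ_j = α(W_j) / (ρ * d)`, for `α` representing the Bayes
predictor. Its imputed prediction is unbiased for `f⋆(z)`, with variance of order `1 / (ρ * d)`, and
its expected squared norm is `∫ α² / (ρ² * d)` (`lintegral_risk_subsampled_le`,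
`lintegral_sq_norm_subsampled`). These give the first two terms of the bound. The excess factor `3 *
q` multiplies a risk of at most `E[Y²]` and gives the third. An infimum over `α` brings in
`nuNormSq`. The factor `L² / (l² * (1 - ρ))` is at least `1` and is inserted only at the end. -/

theorem sgdIterate_zero (γ : ℝ) (x : Fin n → Fin d → ℝ) (y : Fin n → ℝ) :
    sgdIterate γ x y 0 = 0 := rfl

theorem sgdIterate_succ (γ : ℝ) (x : Fin n → Fin d → ℝ) (y : Fin n → ℝ) (i : Fin n) :
    sgdIterate γ x y i.succ = sgdIterate γ x y i.castSucc
      + (γ * (y i - x i ⬝ᵥ sgdIterate γ x y i.castSucc)) • x i := by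
  have h : sgdIterate γ x y i.succ = (1 - γ • Matrix.vecMulVec (x i) (x i)).mulVec
      (sgdIterate γ x y i.castSucc) + (γ * y i) • x i := by
    simp [sgdIterate, Fin.induction_succ]
  rw [h, Matrix.sub_mulVec, Matrix.one_mulVec, Matrix.smul_mulVec, Matrix.vecMulVec_mulVec]
  ext j
  simp
  ring

/-- One step of stochastic gradient descent brings the iterate closer to a comparator `θ`,
up to the squared residual of `θ`. -/
theorem sq_dist_sgd_step_le {x θ' θ : Fin d → ℝ} {y γ q : ℝ} (hγ : 0 < γ)
    (hx : γ * (x ⬝ᵥ x) ≤ q) (hq : q ≤ 1) :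
    (θ' + (γ * (y - x ⬝ᵥ θ')) • x - θ) ⬝ᵥ (θ' + (γ * (y - x ⬝ᵥ θ')) • x - θ)
        + γ * (1 - q / 2) * (y - x ⬝ᵥ θ') ^ 2
      ≤ (θ' - θ) ⬝ᵥ (θ' - θ) + γ * (1 + q) * (y - x ⬝ᵥ θ) ^ 2 := by
  have hxx : 0 ≤ x ⬝ᵥ x := Finset.sum_nonneg fun i _ => mul_self_nonneg _
  have hq0 : 0 ≤ q := le_trans (by positivity) hx
  set r := y - x ⬝ᵥ θ' with hr
  set s := y - x ⬝ᵥ θ with hs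
  have h1 : θ' + (γ * r) • x - θ = (θ' - θ) + (γ * r) • x := by abel
  have h2 : x ⬝ᵥ (θ' - θ) = s - r := by rw [dotProduct_sub, hr, hs]; ring
  have h3 : (θ' + (γ * r) • x - θ) ⬝ᵥ (θ' + (γ * r) • x - θ)
      = (θ' - θ) ⬝ᵥ (θ' - θ) + 2 * γ * r * (s - r) + γ * r ^ 2 * (γ * (x ⬝ᵥ x)) := by
    rw [h1]
    simp only [add_dotProduct, dotProduct_add, smul_dotProduct, dotProduct_smul, smul_eq_mul]
    rw [dotProduct_comm (θ' - θ) x, h2]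
    ring
  have h4 : γ * r ^ 2 * (γ * (x ⬝ᵥ x)) ≤ γ * r ^ 2 * q :=
    mul_le_mul_of_nonneg_left hx (by positivity)
  -- The left side equals `-(1 - q) * (r - s)² - (q / 2) * (r - 2 * s)²`.
  have h5 : 2 * r * (s - r) + r ^ 2 * q + (1 - q / 2) * r ^ 2 - (1 + q) * s ^ 2 ≤ 0 := by
    nlinarith [mul_nonneg hq0 (sq_nonneg (r - 2 * s)),
      mul_nonneg (sub_nonneg.2 hq) (sq_nonneg (r - s))]
  have h6 := mul_nonpos_of_nonneg_of_nonpos hγ.le h5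
  rw [h3]
  linarith

/-- The one-step inequalities telescope from `θ_0 = 0`, and the final squared distance is dropped.
-/
theorem sum_sq_residual_sgdIterate_le {x : Fin n → Fin d → ℝ} {y : Fin n → ℝ} {γ q : ℝ}
    (hγ : 0 < γ) (hx : ∀ i, γ * (x i ⬝ᵥ x i) ≤ q) (hq : q ≤ 1) (θ : Fin d → ℝ) :
    γ * (1 - q / 2) * ∑ i, (y i - x i ⬝ᵥ sgdIterate γ x y i.castSucc) ^ 2
      ≤ θ ⬝ᵥ θ + γ * (1 + q) * ∑ i, (y i - x i ⬝ᵥ θ) ^ 2 := by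
  set a : Fin (n + 1) → ℝ := fun t => (sgdIterate γ x y t - θ) ⬝ᵥ (sgdIterate γ x y t - θ) with ha
  have hstep : ∀ i : Fin n, a i.succ
      + γ * (1 - q / 2) * (y i - x i ⬝ᵥ sgdIterate γ x y i.castSucc) ^ 2
        ≤ a i.castSucc + γ * (1 + q) * (y i - x i ⬝ᵥ θ) ^ 2 := fun i => by
    simp only [ha]
    rw [sgdIterate_succ]
    exact sq_dist_sgd_step_le hγ (hx i) hq
  have hsum := Finset.sum_le_sum fun i (_ : i ∈ Finset.univ) => hstep i
  simp only [Finset.sum_add_distrib, ← Finset.mul_sum] at hsum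
  have h1 := (Fin.sum_univ_succ a).symm.trans (Fin.sum_univ_castSucc a)
  have h2 : a 0 = θ ⬝ᵥ θ := by simp [ha, sgdIterate_zero]
  have h3 : 0 ≤ a (Fin.last n) := Finset.sum_nonneg fun i _ => mul_self_nonneg _
  linarith

/-- Division by `1 - q / 2 ≥ 1 / 2`. The comparator's loss keeps a factor `1 + O(q)`; a fixed
constant larger than `1` would leave a multiple of the optimal risk that does not vanish. -/
theorem sum_sq_residual_sgdIterate_le' {x : Fin n → Fin d → ℝ} {y : Fin n → ℝ} {γ q : ℝ}
    (hγ : 0 < γ) (hx : ∀ i, γ * (x i ⬝ᵥ x i) ≤ q) (hq0 : 0 ≤ q) (hq : q ≤ 1) (θ : Fin d → ℝ) :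
    ∑ i, (y i - x i ⬝ᵥ sgdIterate γ x y i.castSucc) ^ 2
      ≤ 2 * (θ ⬝ᵥ θ) / γ + (1 + 3 * q) * ∑ i, (y i - x i ⬝ᵥ θ) ^ 2 := by
  have h := sum_sq_residual_sgdIterate_le hγ hx hq θ (y := y)
  have hθ : 0 ≤ θ ⬝ᵥ θ := Finset.sum_nonneg fun i _ => mul_self_nonneg _
  have hs : 0 ≤ ∑ i, (y i - x i ⬝ᵥ θ) ^ 2 := Finset.sum_nonneg fun i _ => sq_nonneg _
  set A := ∑ i, (y i - x i ⬝ᵥ sgdIterate γ x y i.castSucc) ^ 2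
  set B := ∑ i, (y i - x i ⬝ᵥ θ) ^ 2
  have hc : 0 < γ * (1 - q / 2) := mul_pos hγ (by linarith)
  refine le_of_mul_le_mul_left (h.trans ?_) hc
  have e : γ * (1 - q / 2) * (2 * (θ ⬝ᵥ θ) / γ + (1 + 3 * q) * B)
      = (2 - q) * (θ ⬝ᵥ θ) + γ * B * ((1 - q / 2) * (1 + 3 * q)) := by
    field_simp
  rw [e]
  have h1 : θ ⬝ᵥ θ ≤ (2 - q) * (θ ⬝ᵥ θ) := by nlinarith
  have h2 : γ * B * (1 + q) ≤ γ * B * ((1 - q / 2) * (1 + 3 * q)) :=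
    mul_le_mul_of_nonneg_left (by nlinarith) (by positivity)
  linarith

/-- The iterate at time `t` depends only on the samples stored before index `t`, so runs of lengths
`n` and `n + 1` can be compared. -/
theorem sgdIterate_castSucc_congr {γ : ℝ} {x' : Fin (n + 1) → Fin d → ℝ} {y' : Fin (n + 1) → ℝ}
    {x : Fin n → Fin d → ℝ} {y : Fin n → ℝ} (t : Fin (n + 1))
    (h : ∀ i : Fin n, i.castSucc < t → x' i.castSucc = x i ∧ y' i.castSucc = y i) :
    sgdIterate γ x' y' t.castSucc = sgdIterate γ x y t := by
  induction t using Fin.induction with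
  | zero => rfl
  | succ i ih =>
    have hi := h i (Fin.castSucc_lt_succ)
    have ih := ih fun k hk => h k (hk.trans Fin.castSucc_lt_succ)
    rw [← Fin.succ_castSucc, sgdIterate_succ, sgdIterate_succ, hi.1, hi.2, ih]

theorem sgdIterate_insertNth {S : Type*} {γ : ℝ} (x : S → Fin d → ℝ) (y : S → ℝ)
    (t : Fin (n + 1)) (a : S) (s : Fin n → S) :
    sgdIterate γ (fun i => x (t.insertNth (α := fun _ => S) a s i))
      (fun i => y (t.insertNth (α := fun _ => S) a s i)) t.castSucc
      = sgdIterate γ (fun i => x (s i)) (fun i => y (s i)) t := by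
  refine sgdIterate_castSucc_congr t fun i hi => ?_
  have : t.insertNth (α := fun _ => S) a s i.castSucc = s i := by
    rw [← Fin.succAbove_of_castSucc_lt t i hi, Fin.insertNth_apply_succAbove]
  simp only [this, and_self]

theorem measurable_sgdIterate {Ω : Type*} [MeasurableSpace Ω] (γ : ℝ)
    {x : Ω → Fin n → Fin d → ℝ} {y : Ω → Fin n → ℝ} (hx : Measurable x) (hy : Measurable y)
    (t : Fin (n + 1)) : Measurable fun ω => sgdIterate γ (x ω) (y ω) t := by
  induction t using Fin.induction with
  | zero => exact measurable_const
  | succ i ih =>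
    simp_rw [sgdIterate_succ]
    refine measurable_pi_lambda _ fun j => ?_
    simp only [Pi.add_apply, Pi.smul_apply, smul_eq_mul, dotProduct]
    have h1 : ∀ k, Measurable fun ω => x ω i k := fun k => by fun_prop
    have h2 : Measurable fun ω => y ω i := by fun_prop
    have h3 : ∀ k, Measurable fun ω => sgdIterate γ (x ω) (y ω) i.castSucc k :=
      fun k => (measurable_pi_apply k).comp ih
    fun_prop

theorem measurable_sgdAverage {Ω : Type*} [MeasurableSpace Ω] (γ : ℝ)
    {x : Ω → Fin n → Fin d → ℝ} {y : Ω → Fin n → ℝ} (hx : Measurable x) (hy : Measurable y) :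
    Measurable fun ω => sgdAverage γ (x ω) (y ω) := by
  unfold sgdAverage
  have := measurable_sgdIterate γ hx hy
  fun_prop

/-- Jensen's inequality. Since `θ_0 = 0`, dividing `θ_1 + … + θ_n` by `n + 1` gives the true mean of
all `n + 1` iterates. -/
theorem sq_residual_sgdAverage_le (γ : ℝ) (x : Fin n → Fin d → ℝ) (y : Fin n → ℝ)
    (a : Fin d → ℝ) (b : ℝ) :
    (b - a ⬝ᵥ sgdAverage γ x y) ^ 2
      ≤ ((n : ℝ) + 1)⁻¹ * ∑ t, (b - a ⬝ᵥ sgdIterate γ x y t) ^ 2 := by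
  have hn : (0 : ℝ) < n + 1 := by positivity
  have h1 : b - a ⬝ᵥ sgdAverage γ x y
      = ((n : ℝ) + 1)⁻¹ * ∑ t, (b - a ⬝ᵥ sgdIterate γ x y t) := by
    have : ∑ i : Fin n, sgdIterate γ x y i.succ = ∑ t, sgdIterate γ x y t := by
      rw [Fin.sum_univ_succ, sgdIterate_zero, zero_add]
    rw [sgdAverage, this, dotProduct_smul, dotProduct_sum, Finset.sum_sub_distrib]
    simp only [smul_eq_mul, Finset.sum_const, Finset.card_univ, Fintype.card_fin, nsmul_eq_mul]
    push_cast
    field_simp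
  have h2 := sq_sum_le_card_mul_sum_sq (s := (Finset.univ : Finset (Fin (n + 1))))
    (f := fun t => b - a ⬝ᵥ sgdIterate γ x y t)
  simp only [Finset.card_univ, Fintype.card_fin] at h2
  push_cast at h2
  rw [h1, mul_pow]
  calc _ ≤ (((n : ℝ) + 1)⁻¹) ^ 2 * (((n : ℝ) + 1) * ∑ t, (b - a ⬝ᵥ sgdIterate γ x y t) ^ 2) :=
        mul_le_mul_of_nonneg_left h2 (by positivity)
    _ = _ := by field_simp

end SGD

/-! ### From regret to expected risk. -/

section SGDExpectation

variable {S : Type*} [MeasurableSpace S] {m : Measure S} [IsProbabilityMeasure m] {n d : ℕ}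

theorem measurable_dotProduct {Ω : Type*} [MeasurableSpace Ω] {u v : Ω → Fin d → ℝ}
    (hu : Measurable u) (hv : Measurable v) : Measurable fun ω => u ω ⬝ᵥ v ω := by
  unfold dotProduct
  fun_prop

/-- The risk of an iterate on a fresh sample is its expected loss on the next sample of a
longer run. -/
theorem lintegral_risk_sgdIterate {x : S → Fin d → ℝ} {y : S → ℝ} (hx : Measurable x)
    (hy : Measurable y) (γ : ℝ) (t : Fin (n + 1)) :
    ∫⁻ s, ∫⁻ a, ENNReal.ofReal ((y a - x a ⬝ᵥ
        sgdIterate γ (fun i => x (s i)) (fun i => y (s i)) t) ^ 2) ∂m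
          ∂(Measure.pi fun _ : Fin n => m)
      = ∫⁻ s, ENNReal.ofReal ((y (s t) - x (s t) ⬝ᵥ
        sgdIterate γ (fun i => x (s i)) (fun i => y (s i)) t.castSucc) ^ 2)
          ∂(Measure.pi fun _ : Fin (n + 1) => m) := by
  have hmeas : ∀ (k : ℕ) (t : Fin (k + 1)), Measurable fun s : Fin k → S =>
      sgdIterate γ (fun i => x (s i)) (fun i => y (s i)) t := fun k t =>
    measurable_sgdIterate γ (by fun_prop) (by fun_prop) t
  -- The test point is inserted at index `t` of the training sample: the product law is preserved
  -- and the iterate at time `t` does not see it.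
  have mp := (measurePreserving_piFinSuccAbove (fun _ : Fin (n + 1) => m) t).symm
  rw [← mp.lintegral_comp]
  · simp only [MeasurableEquiv.piFinSuccAbove_symm_apply, Fin.insertNthEquiv_apply,
      Fin.insertNth_apply_same, sgdIterate_insertNth]
    rw [lintegral_prod_symm]
    refine Measurable.aemeasurable (ENNReal.measurable_ofReal.comp (Measurable.pow_const
      (Measurable.sub (by fun_prop) (measurable_dotProduct (by fun_prop)
        ((hmeas n t).comp measurable_snd))) 2))
  · exact ENNReal.measurable_ofReal.comp (Measurable.pow_const
      (Measurable.sub (by fun_prop) (measurable_dotProduct (by fun_prop) (hmeas _ _))) 2)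

/-- The regret bound over `n + 1` steps, averaged over the sample. Working in `ENNReal` avoids any
integrability assumption on the losses. -/
theorem lintegral_risk_sgdAverage_le {x : S → Fin d → ℝ} {y : S → ℝ} (hx : Measurable x)
    (hy : Measurable y) {γ q : ℝ} (hγ : 0 < γ) (hq0 : 0 ≤ q) (hq : q ≤ 1)
    (hxq : ∀ᵐ a ∂m, γ * (x a ⬝ᵥ x a) ≤ q) (θ : Fin d → ℝ) :
    ∫⁻ s, ∫⁻ a, ENNReal.ofReal ((y a - x a ⬝ᵥ
        sgdAverage γ (fun i => x (s i)) (fun i => y (s i))) ^ 2) ∂m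
          ∂(Measure.pi fun _ : Fin n => m)
      ≤ ENNReal.ofReal (2 / (γ * (n + 1)) * (θ ⬝ᵥ θ))
        + ENNReal.ofReal (1 + 3 * q) * ∫⁻ a, ENNReal.ofReal ((y a - x a ⬝ᵥ θ) ^ 2) ∂m := by
  have hn : (0 : ℝ) < n + 1 := by positivity
  have hθ : 0 ≤ θ ⬝ᵥ θ := Finset.sum_nonneg fun i _ => mul_self_nonneg _
  have hmeas : ∀ (k : ℕ) (t : Fin (k + 1)), Measurable fun s : Fin k → S =>
      sgdIterate γ (fun i => x (s i)) (fun i => y (s i)) t := fun k t =>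
    measurable_sgdIterate γ (by fun_prop) (by fun_prop) t
  have hm1 : ∀ t : Fin (n + 1), Measurable fun p : (Fin n → S) × S =>
      ENNReal.ofReal ((y p.2 - x p.2 ⬝ᵥ
        sgdIterate γ (fun i => x (p.1 i)) (fun i => y (p.1 i)) t) ^ 2) := fun t =>
    ENNReal.measurable_ofReal.comp (Measurable.pow_const
      (Measurable.sub (by fun_prop) (measurable_dotProduct (by fun_prop)
        ((hmeas n t).comp measurable_fst))) 2)
  have hm2 : ∀ t : Fin (n + 1), Measurable fun s : Fin (n + 1) → S =>
      ENNReal.ofReal ((y (s t) - x (s t) ⬝ᵥ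
        sgdIterate γ (fun i => x (s i)) (fun i => y (s i)) t.castSucc) ^ 2) := fun t =>
    ENNReal.measurable_ofReal.comp (Measurable.pow_const
      (Measurable.sub (by fun_prop) (measurable_dotProduct (by fun_prop) (hmeas _ _))) 2)
  have hm3 : Measurable fun a => ENNReal.ofReal ((y a - x a ⬝ᵥ θ) ^ 2) :=
    ENNReal.measurable_ofReal.comp (Measurable.pow_const
      (Measurable.sub hy (measurable_dotProduct hx measurable_const)) 2)
  have hall : ∀ᵐ s ∂(Measure.pi fun _ : Fin (n + 1) => m), ∀ i, γ * (x (s i) ⬝ᵥ x (s i)) ≤ q :=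
    ae_all_iff.2 fun i =>
      (Measure.quasiMeasurePreserving_eval (fun _ : Fin (n + 1) => m) i).ae hxq
  calc _ ≤ ∫⁻ s, ∫⁻ a, ENNReal.ofReal (((n : ℝ) + 1)⁻¹) * ∑ t, ENNReal.ofReal ((y a - x a ⬝ᵥ
        sgdIterate γ (fun i => x (s i)) (fun i => y (s i)) t) ^ 2) ∂m
          ∂(Measure.pi fun _ : Fin n => m) := by
        refine lintegral_mono fun s => lintegral_mono fun a => ?_
        rw [← ENNReal.ofReal_sum_of_nonneg fun _ _ => sq_nonneg _,
          ← ENNReal.ofReal_mul (by positivity)]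
        exact ENNReal.ofReal_le_ofReal (sq_residual_sgdAverage_le _ _ _ _ _)
    _ = ENNReal.ofReal (((n : ℝ) + 1)⁻¹) * ∑ t, ∫⁻ s, ∫⁻ a, ENNReal.ofReal ((y a - x a ⬝ᵥ
        sgdIterate γ (fun i => x (s i)) (fun i => y (s i)) t) ^ 2) ∂m
          ∂(Measure.pi fun _ : Fin n => m) := by
        rw [← lintegral_finsetSum _ fun t _ => (hm1 t).lintegral_prod_right',
          ← lintegral_const_mul _ (Finset.measurable_fun_sum _
            fun t _ => (hm1 t).lintegral_prod_right')]
        refine lintegral_congr fun s => ?_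
        have hs : ∀ t : Fin (n + 1), Measurable fun a => ENNReal.ofReal ((y a - x a ⬝ᵥ
            sgdIterate γ (fun i => x (s i)) (fun i => y (s i)) t) ^ 2) := fun t =>
          (hm1 t).comp measurable_prodMk_left
        rw [lintegral_const_mul _ (Finset.measurable_fun_sum _ fun t _ => hs t),
          lintegral_finsetSum _ fun t _ => hs t]
    _ = ENNReal.ofReal (((n : ℝ) + 1)⁻¹) * ∫⁻ s, ENNReal.ofReal (∑ t, (y (s t) - x (s t) ⬝ᵥ
        sgdIterate γ (fun i => x (s i)) (fun i => y (s i)) t.castSucc) ^ 2)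
          ∂(Measure.pi fun _ : Fin (n + 1) => m) := by
        simp_rw [lintegral_risk_sgdIterate hx hy γ]
        rw [← lintegral_finsetSum _ fun t _ => hm2 t]
        simp_rw [ENNReal.ofReal_sum_of_nonneg fun _ _ => sq_nonneg _]
    _ ≤ ENNReal.ofReal (((n : ℝ) + 1)⁻¹) * ∫⁻ s, (ENNReal.ofReal (2 * (θ ⬝ᵥ θ) / γ)
          + ENNReal.ofReal (1 + 3 * q) * ∑ t, ENNReal.ofReal ((y (s t) - x (s t) ⬝ᵥ θ) ^ 2))
          ∂(Measure.pi fun _ : Fin (n + 1) => m) := by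
        refine mul_le_mul_right (lintegral_mono_ae ?_) _
        filter_upwards [hall] with s hs
        rw [← ENNReal.ofReal_sum_of_nonneg fun _ _ => sq_nonneg _,
          ← ENNReal.ofReal_mul (by positivity), ← ENNReal.ofReal_add (by positivity)
          (mul_nonneg (by positivity) (Finset.sum_nonneg fun _ _ => sq_nonneg _))]
        exact ENNReal.ofReal_le_ofReal (sum_sq_residual_sgdIterate_le' hγ hs hq0 hq θ)
    -- The `n + 1` losses of the fixed `θ` have the same mean, and their number cancels the
    -- averaging factor exactly.
    _ = ENNReal.ofReal (((n : ℝ) + 1)⁻¹) * (ENNReal.ofReal (2 * (θ ⬝ᵥ θ) / γ)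
          + ENNReal.ofReal (1 + 3 * q) * (ENNReal.ofReal ((n : ℝ) + 1)
            * ∫⁻ a, ENNReal.ofReal ((y a - x a ⬝ᵥ θ) ^ 2) ∂m)) := by
        have hm4 : ∀ t : Fin (n + 1), Measurable fun s : Fin (n + 1) → S =>
            ENNReal.ofReal ((y (s t) - x (s t) ⬝ᵥ θ) ^ 2) := fun t =>
          hm3.comp (measurable_pi_apply t)
        rw [lintegral_add_left measurable_const, lintegral_const_mul _ (Finset.measurable_fun_sum _
            fun t _ => hm4 t), lintegral_finsetSum _ fun t _ => hm4 t]
        · have : ∀ t : Fin (n + 1), ∫⁻ s, ENNReal.ofReal ((y (s t) - x (s t) ⬝ᵥ θ) ^ 2)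
              ∂(Measure.pi fun _ : Fin (n + 1) => m)
              = ∫⁻ a, ENNReal.ofReal ((y a - x a ⬝ᵥ θ) ^ 2) ∂m := fun t =>
            (measurePreserving_eval (fun _ : Fin (n + 1) => m) t).lintegral_comp hm3
          simp only [this, Finset.sum_const, Finset.card_univ, Fintype.card_fin, nsmul_eq_mul,
            lintegral_const, measure_univ, mul_one]
          congr 4
          rw [ENNReal.ofReal_add (by positivity) zero_le_one]
          simp
    _ = _ := by
        rw [mul_add, ← ENNReal.ofReal_mul (by positivity)]
        congr 1
        · congr 1
          field_simp
        · rw [mul_left_comm, ← mul_assoc (ENNReal.ofReal ((n : ℝ) + 1)⁻¹),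
            ← ENNReal.ofReal_mul (by positivity), inv_mul_cancel₀ hn.ne', ENNReal.ofReal_one,
            one_mul]

end SGDExpectation

/-! ### Moments of masked sums. -/

instance isProbabilityMeasure_maskLaw (ρ : unitInterval) (d : ℕ) :
    IsProbabilityMeasure (maskLaw ρ d) := by
  unfold maskLaw
  infer_instance

section Mask

theorem memLp_id_bernoulliMeasure (ρ : unitInterval) :
    MemLp (fun x : ℝ => x) 2 (bernoulliMeasure (1 : ℝ) 0 ρ) := by
  refine MemLp.of_bound (by fun_prop) 1 ?_
  rw [bernoulliMeasure_def, ae_add_measure_iff]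
  constructor <;> refine Measure.ae_smul_measure ?_ _ <;> simp [ae_dirac_eq]

theorem integral_id_bernoulliMeasure (ρ : unitInterval) :
    ∫ x, x ∂(bernoulliMeasure (1 : ℝ) 0 ρ) = ρ := by
  simp [integral_bernoulliMeasure (X := ℝ) 1 0 ρ (fun x => x)]

theorem variance_id_bernoulliMeasure (ρ : unitInterval) :
    Var[fun x => x; bernoulliMeasure (1 : ℝ) 0 ρ] = ρ * (1 - ρ) := by
  rw [variance_eq_sub (memLp_id_bernoulliMeasure ρ), integral_id_bernoulliMeasure]
  have := integral_bernoulliMeasure (X := ℝ) 1 0 ρ (fun x => x ^ 2)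
  simp only [Pi.pow_apply]
  rw [this]
  simp
  ring

theorem ae_maskLaw_sq_le_one (ρ : unitInterval) (d : ℕ) :
    ∀ᵐ p ∂(maskLaw ρ d), ∀ j, p j ^ 2 ≤ 1 := by
  refine ae_all_iff.2 fun j => ?_
  refine (Measure.quasiMeasurePreserving_eval
    (fun _ : Fin d => bernoulliMeasure (1 : ℝ) 0 ρ) j).ae (p := fun x : ℝ => x ^ 2 ≤ 1) ?_
  rw [bernoulliMeasure_def, ae_add_measure_iff]
  constructor <;> refine Measure.ae_smul_measure ?_ _ <;> simp [ae_dirac_eq]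

/-- Bias-variance decomposition for a weighted sum of i.i.d. variables. -/
theorem lintegral_sq_sub_sum_pi {A : Type*} [MeasurableSpace A] {m : Measure A}
    [IsProbabilityMeasure m] {h : A → ℝ} (hh : MemLp h 2 m) {d : ℕ} (c : Fin d → ℝ) (y : ℝ) :
    ∫⁻ ω, ENNReal.ofReal ((y - ∑ j, c j * h (ω j)) ^ 2) ∂(Measure.pi fun _ : Fin d => m)
      = ENNReal.ofReal ((y - (∫ a, h a ∂m) * ∑ j, c j) ^ 2 + Var[h; m] * ∑ j, c j ^ 2) := by
  have hX : ∀ j, MemLp (fun ω : Fin d → A => c j * h (ω j)) 2 (Measure.pi fun _ => m) :=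
    fun j => (hh.comp_measurePreserving (measurePreserving_eval (fun _ => m) j)).const_mul (c j)
  have hS : MemLp (fun ω : Fin d → A => ∑ j, c j * h (ω j)) 2 (Measure.pi fun _ => m) :=
    memLp_finsetSum _ fun j _ => hX j
  have hD : MemLp (fun ω : Fin d → A => y - ∑ j, c j * h (ω j)) 2 (Measure.pi fun _ => m) :=
    (memLp_const y).sub hS
  have hvar : Var[fun ω : Fin d → A => ∑ j, c j * h (ω j); Measure.pi fun _ => m]
      = Var[h; m] * ∑ j, c j ^ 2 := by
    have h1 := variance_sum_pi (μ := fun _ : Fin d => m) (X := fun j a => c j * h a)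
      fun j => hh.const_mul (c j)
    have h2 : (∑ j, fun ω : Fin d → A => c j * h (ω j)) = fun ω => ∑ j, c j * h (ω j) := by
      ext ω; simp
    rw [h2] at h1
    rw [h1, Finset.mul_sum]
    exact Finset.sum_congr rfl fun j _ => by rw [variance_const_mul, mul_comm]
  have hint : ∫ ω, (∑ j, c j * h (ω j)) ∂(Measure.pi fun _ : Fin d => m)
      = (∫ a, h a ∂m) * ∑ j, c j := by
    rw [integral_finsetSum _ fun j _ => (hX j).integrable one_le_two, Finset.mul_sum]
    refine Finset.sum_congr rfl fun j _ => ?_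
    rw [integral_const_mul, integral_comp_eval hh.aestronglyMeasurable, mul_comm]
  have h3 := variance_eq_sub hD
  have h4 : Var[fun ω : Fin d → A => y - ∑ j, c j * h (ω j); Measure.pi fun _ => m]
      = Var[h; m] * ∑ j, c j ^ 2 := by
    rw [← hvar]
    exact variance_const_sub hS.aestronglyMeasurable y
  have h5 : ∫ ω, (y - ∑ j, c j * h (ω j)) ∂(Measure.pi fun _ : Fin d => m)
      = y - (∫ a, h a ∂m) * ∑ j, c j := by
    rw [integral_sub (integrable_const _) (hS.integrable one_le_two), hint]
    simp
  rw [h4, h5] at h3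
  rw [← ofReal_integral_eq_lintegral_ofReal hD.integrable_sq
    (Filter.Eventually.of_forall fun _ => sq_nonneg _)]
  congr 1
  simp only [Pi.pow_apply] at h3
  linarith

/-- A masked random feature sum estimates its mean with an error of order `1 / d`. -/
theorem lintegral_sq_sub_masked_sum_le {𝒲 : Type*} [MeasurableSpace 𝒲] {ν : Measure 𝒲}
    [IsProbabilityMeasure ν] {a : 𝒲 → ℝ} (ham : Measurable a) (ha : MemLp a 2 ν)
    (ρ : unitInterval) (d : ℕ) (y : ℝ) :
    ∫⁻ w, ∫⁻ p, ENNReal.ofReal ((y - ∑ j, a (w j) * p j) ^ 2) ∂(maskLaw ρ d)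
        ∂(Measure.pi fun _ : Fin d => ν)
      ≤ ENNReal.ofReal ((y - ρ * d * ∫ w, a w ∂ν) ^ 2)
        + ENNReal.ofReal (ρ * d) * ∫⁻ w, ENNReal.ofReal (a w ^ 2) ∂ν := by
  have hρ0 : (0 : ℝ) ≤ ρ := ρ.2.1
  have hρ1 : (0 : ℝ) ≤ 1 - ρ := sub_nonneg.2 ρ.2.2
  -- Bias and variance over the mask with the weights frozen; the weights are integrated afterwards
  -- by the same lemma.
  have h1 : ∀ w : Fin d → 𝒲, ∫⁻ p, ENNReal.ofReal ((y - ∑ j, a (w j) * p j) ^ 2) ∂(maskLaw ρ d)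
      = ENNReal.ofReal ((y - ∑ j, ρ * a (w j)) ^ 2)
        + ENNReal.ofReal (ρ * (1 - ρ)) * ∑ j, ENNReal.ofReal (a (w j) ^ 2) := fun w => by
    have := lintegral_sq_sub_sum_pi (memLp_id_bernoulliMeasure ρ) (fun j => a (w j)) y
    rw [integral_id_bernoulliMeasure, variance_id_bernoulliMeasure] at this
    rw [maskLaw, this, ENNReal.ofReal_add (sq_nonneg _) (mul_nonneg (mul_nonneg hρ0 hρ1)
      (Finset.sum_nonneg fun _ _ => sq_nonneg _)), Finset.mul_sum,
      ENNReal.ofReal_mul (mul_nonneg hρ0 hρ1), ENNReal.ofReal_sum_of_nonneg fun _ _ => sq_nonneg _]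
  have h2 : ∀ j : Fin d, ∫⁻ w, ENNReal.ofReal (a (w j) ^ 2) ∂(Measure.pi fun _ : Fin d => ν)
      = ∫⁻ w, ENNReal.ofReal (a w ^ 2) ∂ν := fun j =>
    (measurePreserving_eval (fun _ : Fin d => ν) j).lintegral_comp
      (f := fun w => ENNReal.ofReal (a w ^ 2)) (by fun_prop)
  have h3 : ∫⁻ w, ENNReal.ofReal (a w ^ 2) ∂ν = ENNReal.ofReal (∫ w, a w ^ 2 ∂ν) :=
    (ofReal_integral_eq_lintegral_ofReal ha.integrable_sq
      (Filter.Eventually.of_forall fun _ => sq_nonneg _)).symm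
  have h4 : Var[a; ν] ≤ ∫ w, a w ^ 2 ∂ν := by
    simpa using variance_le_expectation_sq ha.aestronglyMeasurable
  have h5 : 0 ≤ ∫ w, a w ^ 2 ∂ν := integral_nonneg fun _ => sq_nonneg _
  simp_rw [h1]
  rw [lintegral_add_left (by fun_prop), lintegral_const_mul _ (by fun_prop),
    lintegral_finsetSum _ fun j _ => by fun_prop, lintegral_sq_sub_sum_pi ha]
  simp only [h2, Finset.sum_const, Finset.card_univ, Fintype.card_fin, nsmul_eq_mul, h3]
  rw [← ENNReal.ofReal_natCast, ← ENNReal.ofReal_mul (by positivity),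
    ← ENNReal.ofReal_mul (by positivity), ← ENNReal.ofReal_mul (by positivity),
    ← ENNReal.ofReal_add (add_nonneg (sq_nonneg _) (mul_nonneg (variance_nonneg _ _)
      (by positivity))) (by positivity),
    ← ENNReal.ofReal_add (by positivity) (by positivity)]
  refine ENNReal.ofReal_le_ofReal ?_
  -- The weights contribute at most `ρ² * d * ∫ a²` and the mask `ρ * (1 - ρ) * d * ∫ a²`; together
  -- they make `ρ * d * ∫ a²`.
  have h6 := mul_le_mul_of_nonneg_right h4 (by positivity : (0 : ℝ) ≤ d * ρ ^ 2)
  rw [show y - (∫ w, a w ∂ν) * (d * (ρ : ℝ)) = y - ρ * d * ∫ w, a w ∂ν by ring]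
  nlinarith

end Mask

/-! ### The feature class, the Bayes predictor and the subsampled comparator. -/

section FeatureClass

variable {𝒵 𝒲 : Type*} {ψ : 𝒵 → 𝒲 → ℝ} {f : 𝒵 → ℝ} {α : 𝒲 → ℝ}

theorem zeroImpute_dotProduct_div {d : ℕ} (c : ℝ) (α : 𝒲 → ℝ) (z : 𝒵) (w : Fin d → 𝒲)
    (p : Fin d → ℝ) :
    zeroImpute p (featureVec ψ z w) ⬝ᵥ (fun j => α (w j) / c)
      = ∑ j, α (w j) * ψ z (w j) / c * p j :=
  Finset.sum_congr rfl fun j _ => by simp only [zeroImpute, featureVec]; ring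

variable [MeasurableSpace 𝒲] {ν : Measure 𝒲}

/-- A representation may be replaced by a measurable one. -/
theorem Represents.exists_measurable (h : Represents ψ ν α f) :
    ∃ β, Measurable β ∧ Represents ψ ν β f ∧ ∫ w, β w ^ 2 ∂ν = ∫ w, α w ^ 2 ∂ν := by
  have hae := h.1.aestronglyMeasurable.ae_eq_mk
  refine ⟨h.1.aestronglyMeasurable.mk α, h.1.aestronglyMeasurable.stronglyMeasurable_mk.measurable,
    ⟨(memLp_congr_ae hae).1 h.1, fun z => ?_⟩, ?_⟩
  · have hz : (fun w => α w * ψ z w) =ᵐ[ν] fun w => h.1.aestronglyMeasurable.mk α w * ψ z w := by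
      filter_upwards [hae] with w hw
      rw [hw]
    exact ⟨(h.2 z).1.congr hz, by rw [(h.2 z).2, integral_congr_ae hz]⟩
  · refine integral_congr_ae ?_
    filter_upwards [hae] with w hw
    rw [hw]

theorem zero_mem_featureClass : (0 : 𝒵 → ℝ) ∈ featureClass ψ ν :=
  ⟨0, MemLp.zero, fun z => by simp⟩

variable [MeasurableSpace 𝒵] {μ : Measure (𝒵 × ℝ)}

theorem ae_of_ae_fst [IsProbabilityMeasure μ] {p : 𝒵 → Prop} (h : ∀ᵐ z ∂μ.fst, p z) :
    ∀ᵐ q ∂μ, p q.1 :=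
  ae_of_ae_map measurable_fst.aemeasurable h

theorem measurable_of_mem_featureClass [IsProbabilityMeasure ν]
    (hψ : Measurable (Function.uncurry ψ)) (hf : f ∈ featureClass ψ ν) : Measurable f := by
  obtain ⟨α, hα⟩ := hf
  obtain ⟨β, hβm, hβ, -⟩ := hα.exists_measurable
  have : f = fun z => ∫ w, β w * ψ z w ∂ν := funext fun z => (hβ.2 z).2
  rw [this]
  have hm : Measurable (Function.uncurry fun (z : 𝒵) (w : 𝒲) => β w * ψ z w) :=
    (hβm.comp measurable_snd).mul hψ
  exact hm.stronglyMeasurable.integral_prod_right.measurable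

/-- Bounded features make `f` almost surely bounded, by `√K * ∫ |α|`. -/
theorem memLp_of_mem_featureClass [IsProbabilityMeasure ν] [IsProbabilityMeasure μ] {K : ℝ}
    (hψ : Measurable (Function.uncurry ψ))
    (hb : ∀ᵐ q ∂(μ.fst.prod ν), |ψ q.1 q.2| ^ 2 ≤ K) (hf : f ∈ featureClass ψ ν) :
    MemLp (fun q : 𝒵 × ℝ => f q.1) 2 μ := by
  have hfm := measurable_of_mem_featureClass hψ hf
  obtain ⟨α, hα⟩ := hf
  refine MemLp.of_bound (hfm.comp measurable_fst).aestronglyMeasurable (∫ w, |α w| * √K ∂ν) ?_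
  filter_upwards [ae_of_ae_fst (Measure.ae_ae_of_ae_prod hb)] with q hq
  rw [(hα.2 q.1).2]
  refine (norm_integral_le_integral_norm _).trans
    (integral_mono_ae (hα.2 q.1).1.norm ((hα.1.integrable one_le_two).abs.mul_const _) ?_)
  filter_upwards [hq] with w hw
  simp only [norm_mul, Real.norm_eq_abs]
  exact mul_le_mul_of_nonneg_left (Real.le_sqrt_of_sq_le hw) (abs_nonneg _)

theorem bddBelow_latentRisk (s : Set (𝒵 → ℝ)) : BddBelow (latentRisk μ '' s) :=
  ⟨0, by rintro _ ⟨f, -, rfl⟩; exact integral_nonneg fun _ => sq_nonneg _⟩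

theorem bestRiskInfty_le_integral_sq : bestRiskInfty ψ ν μ ≤ ∫ q, q.2 ^ 2 ∂μ :=
  csInf_le (bddBelow_latentRisk _) ⟨0, zero_mem_featureClass, by simp [latentRisk]⟩

/-- The Bayes predictor minimizes the quadratic risk. -/
theorem IsBayesPredictor.latentRisk_le [IsProbabilityMeasure μ] {g : 𝒵 → ℝ}
    (hf : IsBayesPredictor μ f) (hY : MemLp (fun q : 𝒵 × ℝ => q.2) 2 μ) (hfm : Measurable f)
    (hgm : Measurable g) (hfL : MemLp (fun q : 𝒵 × ℝ => f q.1) 2 μ)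
    (hgL : MemLp (fun q : 𝒵 × ℝ => g q.1) 2 μ) : latentRisk μ f ≤ latentRisk μ g := by
  set Y : 𝒵 × ℝ → ℝ := fun q => q.2
  set F : 𝒵 × ℝ → ℝ := fun q => f q.1
  set D : 𝒵 × ℝ → ℝ := fun q => f q.1 - g q.1
  have hm : MeasurableSpace.comap (Prod.fst : 𝒵 × ℝ → 𝒵) inferInstance ≤ Prod.instMeasurableSpace :=
    measurable_fst.comap_le
  have hDL : MemLp D 2 μ := hfL.sub hgL
  have hDm : StronglyMeasurable[MeasurableSpace.comap (Prod.fst : 𝒵 × ℝ → 𝒵) inferInstance] D :=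
    ((hfm.sub hgm).comp (comap_measurable Prod.fst)).stronglyMeasurable
  have h1 := condExp_mul_of_stronglyMeasurable_right hDm (hY.integrable_mul hDL)
    (hY.integrable one_le_two)
  -- Orthogonality: `Y - f(Z)` is uncorrelated with every square integrable function of `Z`, here
  -- with `D = f(Z) - g(Z)`.
  have h2 : ∫ q, Y q * D q ∂μ = ∫ q, F q * D q ∂μ := by
    calc ∫ q, Y q * D q ∂μ
        = ∫ q, (condExp (MeasurableSpace.comap Prod.fst inferInstance) μ (Y * D)) q ∂μ :=
          (integral_condExp hm).symm
      _ = _ := by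
        refine integral_congr_ae ?_
        filter_upwards [h1, hf] with q hq1 hq2
        rw [hq1, Pi.mul_apply, ← hq2]
  have h3 : Integrable (fun q => (Y q - F q) ^ 2) μ := (hY.sub hfL).integrable_sq
  have h4 : Integrable (fun q => Y q * D q) μ := hY.integrable_mul hDL
  have h5 : Integrable (fun q => F q * D q) μ := hfL.integrable_mul hDL
  have h6 : latentRisk μ g = ∫ q, ((Y q - F q) ^ 2 + 2 * (Y q * D q - F q * D q) + D q ^ 2) ∂μ :=
    integral_congr_ae (Filter.Eventually.of_forall fun q => by simp only [Y, F, D]; ring)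
  have h7 : 0 ≤ ∫ q, D q ^ 2 ∂μ := integral_nonneg fun _ => sq_nonneg _
  have h8 : Integrable (fun q => 2 * (Y q * D q - F q * D q)) μ := (h4.sub h5).const_mul 2
  have h9 : Integrable (fun q => (Y q - F q) ^ 2 + 2 * (Y q * D q - F q * D q)) μ := h3.add h8
  rw [h6, integral_add h9 hDL.integrable_sq, integral_add h3 h8, integral_const_mul,
    integral_sub h4 h5, h2]
  change ∫ q, (Y q - F q) ^ 2 ∂μ ≤ _
  linarith

theorem IsBayesPredictor.latentRisk_le_bestRiskInfty [IsProbabilityMeasure ν]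
    [IsProbabilityMeasure μ] {K : ℝ} (hψ : Measurable (Function.uncurry ψ))
    (hb : ∀ᵐ q ∂(μ.fst.prod ν), |ψ q.1 q.2| ^ 2 ≤ K) (hY : MemLp (fun q : 𝒵 × ℝ => q.2) 2 μ)
    (hf : IsBayesPredictor μ f) (hmem : f ∈ featureClass ψ ν) :
    latentRisk μ f ≤ bestRiskInfty ψ ν μ := by
  refine le_csInf (Set.Nonempty.image _ ⟨f, hmem⟩) ?_
  rintro _ ⟨g, hg, rfl⟩
  exact hf.latentRisk_le hY (measurable_of_mem_featureClass hψ hmem)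
    (measurable_of_mem_featureClass hψ hg) (memLp_of_mem_featureClass hψ hb hmem)
    (memLp_of_mem_featureClass hψ hb hg)

/-- Subsampling a representation of `f` at `d` random features gives, after imputation by zero,
a linear predictor whose expected risk exceeds that of `f` by at most `O(1 / (ρ d))`. -/
theorem lintegral_risk_subsampled_le [IsProbabilityMeasure ν] [IsProbabilityMeasure μ] {K L : ℝ}
    (hψ : Measurable (Function.uncurry ψ))
    (hb : ∀ᵐ q ∂(μ.fst.prod ν), |ψ q.1 q.2| ^ 2 ≤ K)
    (hL : ∀ᵐ w ∂ν, MemLp (fun z => ψ z w) 2 μ.fst ∧ ∫ z, ψ z w ^ 2 ∂μ.fst ≤ L ^ 2)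
    (hαm : Measurable α) (hα : Represents ψ ν α f) {ρ : unitInterval} (hρ : 0 < (ρ : ℝ))
    {d : ℕ} (hd : 0 < d) :
    ∫⁻ w, ∫⁻ q, ENNReal.ofReal ((q.1.2 - zeroImpute q.2 (featureVec ψ q.1.1 w) ⬝ᵥ
        (fun j => α (w j) / (ρ * d))) ^ 2) ∂(μ.prod (maskLaw ρ d))
          ∂(Measure.pi fun _ : Fin d => ν)
      ≤ ∫⁻ q, ENNReal.ofReal ((q.2 - f q.1) ^ 2) ∂μ
        + ENNReal.ofReal (L ^ 2 / (ρ * d) * ∫ w, α w ^ 2 ∂ν) := by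
  have hd' : (0 : ℝ) < d := by exact_mod_cast hd
  have hfm := measurable_of_mem_featureClass hψ ⟨α, hα⟩
  have hψ2 : Measurable fun p : 𝒵 × 𝒲 => ψ p.1 p.2 := hψ
  have hψj : ∀ j : Fin d, Measurable fun p : ((Fin d → 𝒲) × 𝒵 × ℝ) × (Fin d → ℝ) =>
      ψ p.1.2.1 (p.1.1 j) := fun j =>
    hψ2.comp (by fun_prop : Measurable fun p : ((Fin d → 𝒲) × 𝒵 × ℝ) × (Fin d → ℝ) =>
      (p.1.2.1, p.1.1 j))
  have hG : Measurable fun p : ((Fin d → 𝒲) × 𝒵 × ℝ) × (Fin d → ℝ) => ENNReal.ofReal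
      ((p.1.2.2 - ∑ j, α (p.1.1 j) * ψ p.1.2.1 (p.1.1 j) / (ρ * d) * p.2 j) ^ 2) := by
    fun_prop
  have hsec : ∀ᵐ z ∂μ.fst, MemLp (fun w => α w * ψ z w) 2 ν := by
    filter_upwards [Measure.ae_ae_of_ae_prod hb] with z hz
    refine hα.1.of_le_mul (c := √K) ?_ ?_
    · exact (hαm.mul (hψ2.comp measurable_prodMk_left)).aestronglyMeasurable
    · filter_upwards [hz] with w hw
      rw [norm_mul, mul_comm]
      exact mul_le_mul_of_nonneg_right (Real.le_sqrt_of_sq_le hw) (norm_nonneg _)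
  have hpt : ∀ᵐ q ∂μ, ∫⁻ w, ∫⁻ p, ENNReal.ofReal
      ((q.2 - ∑ j, α (w j) * ψ q.1 (w j) / (ρ * d) * p j) ^ 2) ∂(maskLaw ρ d)
        ∂(Measure.pi fun _ : Fin d => ν)
      ≤ ENNReal.ofReal ((q.2 - f q.1) ^ 2) + ENNReal.ofReal (1 / (ρ * d))
        * ∫⁻ w, ENNReal.ofReal (α w ^ 2 * ψ q.1 w ^ 2) ∂ν := by
    filter_upwards [ae_of_ae_fst hsec] with q hq
    have ham : Measurable fun w => α w * ψ q.1 w / (ρ * d) :=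
      (hαm.mul (hψ2.comp measurable_prodMk_left)).div_const _
    have haL : MemLp (fun w => α w * ψ q.1 w / (ρ * d)) 2 ν := by
      simpa only [div_eq_mul_inv] using hq.mul_const ((ρ : ℝ) * d)⁻¹
    -- With the weights scaled by `1 / (ρ * d)`, the masked sum has mean exactly `f(z)`, so the bias
    -- term is the loss of `f` itself.
    refine (lintegral_sq_sub_masked_sum_le ham haL ρ d q.2).trans (le_of_eq ?_)
    congr 1
    · rw [integral_div, ← (hα.2 q.1).2]
      congr 3
      field_simp
    · rw [← lintegral_const_mul _ (by fun_prop), ← lintegral_const_mul]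
      · refine lintegral_congr fun w => ?_
        rw [← ENNReal.ofReal_mul (by positivity), ← ENNReal.ofReal_mul (by positivity)]
        congr 1
        field_simp
      · have : Measurable fun w => ψ q.1 w := hψ2.comp measurable_prodMk_left
        fun_prop
  have hlast : ∫⁻ q, ∫⁻ w, ENNReal.ofReal (α w ^ 2 * ψ q.1 w ^ 2) ∂ν ∂μ
      ≤ ENNReal.ofReal (L ^ 2 * ∫ w, α w ^ 2 ∂ν) := by
    have hm1 : Measurable fun p : 𝒵 × 𝒲 => ENNReal.ofReal (α p.2 ^ 2 * ψ p.1 p.2 ^ 2) := by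
      fun_prop
    calc _ = ∫⁻ z, ∫⁻ w, ENNReal.ofReal (α w ^ 2 * ψ z w ^ 2) ∂ν ∂μ.fst := by
          rw [Measure.fst, lintegral_map hm1.lintegral_prod_right' measurable_fst]
      -- The second-moment bound holds for fixed `w`, so `z` must be integrated first.
      _ = ∫⁻ w, ∫⁻ z, ENNReal.ofReal (α w ^ 2 * ψ z w ^ 2) ∂μ.fst ∂ν :=
          lintegral_lintegral_swap hm1.aemeasurable
      _ ≤ ∫⁻ w, ENNReal.ofReal (L ^ 2 * α w ^ 2) ∂ν := by
          refine lintegral_mono_ae ?_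
          filter_upwards [hL] with w hw
          rw [← ofReal_integral_eq_lintegral_ofReal (hw.1.integrable_sq.const_mul _)
            (Filter.Eventually.of_forall fun _ => by positivity), integral_const_mul, mul_comm]
          exact ENNReal.ofReal_le_ofReal (mul_le_mul_of_nonneg_right hw.2 (sq_nonneg _))
      _ = _ := by
          rw [← ofReal_integral_eq_lintegral_ofReal (hα.1.integrable_sq.const_mul _)
            (Filter.Eventually.of_forall fun _ => by positivity), integral_const_mul]
  simp_rw [zeroImpute_dotProduct_div]
  calc _ = ∫⁻ w, ∫⁻ q, ∫⁻ p, ENNReal.ofReal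
        ((q.2 - ∑ j, α (w j) * ψ q.1 (w j) / (ρ * d) * p j) ^ 2) ∂(maskLaw ρ d) ∂μ
        ∂(Measure.pi fun _ : Fin d => ν) := by
        refine lintegral_congr fun w => ?_
        rw [lintegral_prod]
        exact (hG.comp (by fun_prop : Measurable fun p : (𝒵 × ℝ) × (Fin d → ℝ) =>
          ((w, p.1), p.2))).aemeasurable
    _ = ∫⁻ q, ∫⁻ w, ∫⁻ p, ENNReal.ofReal
        ((q.2 - ∑ j, α (w j) * ψ q.1 (w j) / (ρ * d) * p j) ^ 2) ∂(maskLaw ρ d)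
        ∂(Measure.pi fun _ : Fin d => ν) ∂μ :=
        lintegral_lintegral_swap hG.lintegral_prod_right'.aemeasurable
    _ ≤ _ := lintegral_mono_ae hpt
    _ = _ := lintegral_add_left (by fun_prop) _
    _ ≤ _ := by
        refine add_le_add_right ?_ _
        rw [lintegral_const_mul]
        · refine (mul_le_mul_right hlast _).trans (le_of_eq ?_)
          rw [← ENNReal.ofReal_mul (by positivity)]
          congr 1
          ring
        · have hm1 : Measurable fun p : (𝒵 × ℝ) × 𝒲 =>
              ENNReal.ofReal (α p.2 ^ 2 * ψ p.1.1 p.2 ^ 2) := by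
            have : Measurable fun p : (𝒵 × ℝ) × 𝒲 => ψ p.1.1 p.2 :=
              hψ2.comp (by fun_prop : Measurable fun p : (𝒵 × ℝ) × 𝒲 => (p.1.1, p.2))
            fun_prop
          exact hm1.lintegral_prod_right'

end FeatureClass

/-- True without integrability because the Bochner integral then defaults to `0`. It bounds
`impRisk` before its integrand is known to be integrable. -/
theorem ofReal_integral_le_lintegral {A : Type*} [MeasurableSpace A] {m : Measure A} {f : A → ℝ}
    (hf : ∀ a, 0 ≤ f a) : ENNReal.ofReal (∫ a, f a ∂m) ≤ ∫⁻ a, ENNReal.ofReal (f a) ∂m := by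
  by_cases h : Integrable f m
  · exact (ofReal_integral_eq_lintegral_ofReal h (Filter.Eventually.of_forall hf)).le
  · simp [integral_undef h]

theorem integrable_of_lintegral_ofReal_le {A : Type*} [MeasurableSpace A] {m : Measure A}
    {f : A → ℝ} (hf : ∀ a, 0 ≤ f a) (hm : Measurable f) {B : ℝ} (hB : 0 ≤ B)
    (h : ∫⁻ a, ENNReal.ofReal (f a) ∂m ≤ ENNReal.ofReal B) :
    Integrable f m ∧ ∫ a, f a ∂m ≤ B := by
  have hf' : 0 ≤ᵐ[m] f := Filter.Eventually.of_forall hf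
  have hi : Integrable f m := by
    refine ⟨hm.aestronglyMeasurable, ?_⟩
    rw [hasFiniteIntegral_iff_ofReal hf']
    exact h.trans_lt ENNReal.ofReal_lt_top
  refine ⟨hi, ?_⟩
  rw [← ofReal_integral_eq_lintegral_ofReal hi hf'] at h
  exact (ENNReal.ofReal_le_ofReal_iff hB).1 h

/-! ### Excess risk of the averaged estimator. -/

section ExcessRisk

/-- Passes to the infimum over representations, which need not be attained. -/
theorem le_add_mul_nuNormSq {𝒵 𝒲 : Type*} [MeasurableSpace 𝒲] {ν : Measure 𝒲}
    {ψ : 𝒵 → 𝒲 → ℝ} {f : 𝒵 → ℝ} {a b c : ℝ} (hb : 0 ≤ b) (hf : f ∈ featureClass ψ ν)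
    (h : ∀ α, Represents ψ ν α f → c ≤ b * (∫ w, α w ^ 2 ∂ν) + a) :
    c ≤ b * nuNormSq ψ ν f + a := by
  obtain ⟨α, hα⟩ := hf
  rcases hb.eq_or_lt with rfl | hb
  · simpa using h α hα
  · have : (c - a) / b ≤ nuNormSq ψ ν f := by
      refine le_csInf ⟨_, α, hα, rfl⟩ ?_
      rintro _ ⟨β, hβ, rfl⟩
      rw [div_le_iff₀ hb]
      linarith [h β hβ]
    rw [div_le_iff₀ hb] at this
    linarith

variable {𝒵 𝒲 : Type*} [MeasurableSpace 𝒵] {ψ : 𝒵 → 𝒲 → ℝ} {μ : Measure (𝒵 × ℝ)}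
  {ρ : unitInterval} {n d : ℕ}

theorem impRisk_nonneg (w : Fin d → 𝒲) (θ : Fin d → ℝ) : 0 ≤ impRisk ψ μ ρ w θ :=
  integral_nonneg fun _ => sq_nonneg _

variable [MeasurableSpace 𝒲] {ν : Measure 𝒲} {f : 𝒵 → ℝ} {α : 𝒲 → ℝ}

theorem measurable_zeroImpute_featureVec {A : Type*} [MeasurableSpace A]
    (hψ : Measurable (Function.uncurry ψ)) {p : A → Fin d → ℝ} {z : A → 𝒵} {w : A → Fin d → 𝒲}
    (hp : Measurable p) (hz : Measurable z) (hw : Measurable w) :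
    Measurable fun a => zeroImpute (p a) (featureVec ψ (z a) (w a)) := by
  refine measurable_pi_lambda _ fun j => ?_
  exact Measurable.mul (by fun_prop)
    (hψ.comp (by fun_prop : Measurable fun a => (z a, w a j)))

/-- The imputed inputs have squared norm at most `d K` when the features are bounded by `√K`. -/
theorem ae_zeroImpute_sq_norm_le [IsProbabilityMeasure ν] [IsProbabilityMeasure μ] {K : ℝ}
    (hψ : Measurable (Function.uncurry ψ))
    (hb : ∀ᵐ q ∂(μ.fst.prod ν), |ψ q.1 q.2| ^ 2 ≤ K) (ρ : unitInterval) (d : ℕ) :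
    ∀ᵐ w ∂(Measure.pi fun _ : Fin d => ν), ∀ᵐ q ∂(μ.prod (maskLaw ρ d)),
      zeroImpute q.2 (featureVec ψ q.1.1 w) ⬝ᵥ zeroImpute q.2 (featureVec ψ q.1.1 w) ≤ d * K := by
  have hψ2 : Measurable fun p : 𝒵 × 𝒲 => ψ p.1 p.2 := hψ
  have hb' : ∀ᵐ w ∂ν, ∀ᵐ z ∂μ.fst, |ψ z w| ^ 2 ≤ K := by
    refine (Measure.ae_ae_comm ?_).1 (Measure.ae_ae_of_ae_prod hb)
    exact measurableSet_le (by fun_prop) measurable_const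
  have hall : ∀ᵐ w ∂(Measure.pi fun _ : Fin d => ν), ∀ j, ∀ᵐ z ∂μ.fst, |ψ z (w j)| ^ 2 ≤ K :=
    ae_all_iff.2 fun j =>
      (Measure.quasiMeasurePreserving_eval (fun _ : Fin d => ν) j).ae hb'
  filter_upwards [hall] with w hw
  have h1 : ∀ᵐ q ∂(μ.prod (maskLaw ρ d)), ∀ j, |ψ q.1.1 (w j)| ^ 2 ≤ K :=
    Measure.quasiMeasurePreserving_fst.ae (ae_of_ae_fst (ae_all_iff.2 hw))
  have h2 : ∀ᵐ q ∂(μ.prod (maskLaw ρ d)), ∀ j, q.2 j ^ 2 ≤ 1 :=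
    Measure.quasiMeasurePreserving_snd.ae (ae_maskLaw_sq_le_one ρ d)
  filter_upwards [h1, h2] with q hq1 hq2
  calc zeroImpute q.2 (featureVec ψ q.1.1 w) ⬝ᵥ zeroImpute q.2 (featureVec ψ q.1.1 w)
      ≤ ∑ _j : Fin d, K := by
        refine Finset.sum_le_sum fun j _ => ?_
        simp only [zeroImpute, featureVec]
        have h3 := hq1 j
        rw [sq_abs] at h3
        nlinarith [hq2 j, sq_nonneg (ψ q.1.1 (w j)), sq_nonneg (q.2 j)]
    _ = d * K := by simp

theorem lintegral_sq_norm_subsampled [IsProbabilityMeasure ν] (hαm : Measurable α)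
    (hα : MemLp α 2 ν) {r : ℝ} (hd : 0 < d) {c : ℝ} (hc : 0 ≤ c) :
    ∫⁻ w, ENNReal.ofReal (c * ((fun j => α (w j) / (r * d)) ⬝ᵥ fun j => α (w j) / (r * d)))
        ∂(Measure.pi fun _ : Fin d => ν)
      = ENNReal.ofReal (c * ((∫ w, α w ^ 2 ∂ν) / (r ^ 2 * d))) := by
  have hd' : (d : ℝ) ≠ 0 := by exact_mod_cast hd.ne'
  have h1 : ∀ j : Fin d, Integrable (fun w : Fin d → 𝒲 => α (w j) ^ 2)
      (Measure.pi fun _ : Fin d => ν) := fun j =>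
    (hα.comp_measurePreserving (measurePreserving_eval (fun _ : Fin d => ν) j)).integrable_sq
  have h2 : ∀ w : Fin d → 𝒲,
      c * ((fun j => α (w j) / (r * d)) ⬝ᵥ fun j => α (w j) / (r * d))
        = c / (r * d) ^ 2 * ∑ j, α (w j) ^ 2 := fun w => by
    rw [dotProduct, Finset.mul_sum, Finset.mul_sum]
    exact Finset.sum_congr rfl fun j _ => by ring
  simp_rw [h2]
  rw [← ofReal_integral_eq_lintegral_ofReal ((integrable_finsetSum _ fun j _ => h1 j).const_mul _)
    (Filter.Eventually.of_forall fun w => mul_nonneg (by positivity)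
      (Finset.sum_nonneg fun _ _ => sq_nonneg _)), integral_const_mul,
    integral_finsetSum _ fun j _ => h1 j]
  have h3 : ∀ j : Fin d, ∫ w, α (w j) ^ 2 ∂(Measure.pi fun _ : Fin d => ν) = ∫ w, α w ^ 2 ∂ν :=
    fun j => integral_comp_eval (μ := fun _ : Fin d => ν) (f := fun w => α w ^ 2)
      (hαm.pow_const 2).aestronglyMeasurable
  simp only [h3, Finset.sum_const, Finset.card_univ, Fintype.card_fin, nsmul_eq_mul]
  congr 1
  by_cases hr : r = 0
  · simp [hr]
  · field_simp

/-- Risk bound for averaged stochastic gradient descent, as a function of the weights and of the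
training sample. -/
theorem lintegral_impRisk_sgdAverage_le [IsProbabilityMeasure ν] [IsProbabilityMeasure μ]
    {K L γ : ℝ} (hψ : Measurable (Function.uncurry ψ))
    (hb : ∀ᵐ q ∂(μ.fst.prod ν), |ψ q.1 q.2| ^ 2 ≤ K)
    (hL : ∀ᵐ w ∂ν, MemLp (fun z => ψ z w) 2 μ.fst ∧ ∫ z, ψ z w ^ 2 ∂μ.fst ≤ L ^ 2)
    (hY : MemLp (fun q : 𝒵 × ℝ => q.2) 2 μ)
    (hαm : Measurable α) (hα : Represents ψ ν α f) (hρ : 0 < (ρ : ℝ)) (hd : 0 < d)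
    (hγ : 0 < γ) (hK : 0 ≤ K) (hq : γ * (d * K) ≤ 1) :
    ∫⁻ u, ENNReal.ofReal (impRisk ψ μ ρ u.1 (sgdAverage γ
        (fun i => zeroImpute (u.2 i).2 (featureVec ψ (u.2 i).1.1 u.1)) fun i => (u.2 i).1.2))
          ∂((Measure.pi fun _ : Fin d => ν).prod
            (Measure.pi fun _ : Fin n => μ.prod (maskLaw ρ d)))
      ≤ ENNReal.ofReal (2 / (γ * (n + 1)) * ((∫ w, α w ^ 2 ∂ν) / (ρ ^ 2 * d))
        + (1 + 3 * (γ * (d * K))) * (latentRisk μ f + L ^ 2 / (ρ * d) * ∫ w, α w ^ 2 ∂ν)) := by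
  have hA : 0 ≤ ∫ w, α w ^ 2 ∂ν := integral_nonneg fun _ => sq_nonneg _
  have hR : 0 ≤ latentRisk μ f := integral_nonneg fun _ => sq_nonneg _
  have hq0 : 0 ≤ γ * (d * K) := by positivity
  have hfL := memLp_of_mem_featureClass hψ hb ⟨α, hα⟩
  have hx : Measurable fun v : (Fin d → 𝒲) × ((𝒵 × ℝ) × (Fin d → ℝ)) =>
      zeroImpute v.2.2 (featureVec ψ v.2.1.1 v.1) :=
    measurable_zeroImpute_featureVec hψ (by fun_prop) (by fun_prop) (by fun_prop)
  have hxs : Measurable fun u : (Fin d → 𝒲) × (Fin n → (𝒵 × ℝ) × (Fin d → ℝ)) =>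
      fun i => zeroImpute (u.2 i).2 (featureVec ψ (u.2 i).1.1 u.1) :=
    measurable_pi_lambda _ fun i =>
      measurable_zeroImpute_featureVec hψ (by fun_prop) (by fun_prop) (by fun_prop)
  have havg := measurable_sgdAverage γ hxs
    (by fun_prop : Measurable fun u : (Fin d → 𝒲) × (Fin n → (𝒵 × ℝ) × (Fin d → ℝ)) =>
      fun i => (u.2 i).1.2)
  have hloss : Measurable fun v : ((Fin d → 𝒲) × (Fin n → (𝒵 × ℝ) × (Fin d → ℝ))) ×
      ((𝒵 × ℝ) × (Fin d → ℝ)) => ENNReal.ofReal ((v.2.1.2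
        - zeroImpute v.2.2 (featureVec ψ v.2.1.1 v.1.1) ⬝ᵥ sgdAverage γ
          (fun i => zeroImpute (v.1.2 i).2 (featureVec ψ (v.1.2 i).1.1 v.1.1))
            fun i => (v.1.2 i).1.2) ^ 2) :=
    ENNReal.measurable_ofReal.comp (Measurable.pow_const (Measurable.sub (by fun_prop)
      (measurable_dotProduct (measurable_zeroImpute_featureVec hψ (by fun_prop) (by fun_prop)
        (by fun_prop)) (havg.comp measurable_fst))) 2)
  calc _ ≤ ∫⁻ u, ∫⁻ q, ENNReal.ofReal ((q.1.2
        - zeroImpute q.2 (featureVec ψ q.1.1 u.1) ⬝ᵥ sgdAverage γ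
          (fun i => zeroImpute (u.2 i).2 (featureVec ψ (u.2 i).1.1 u.1))
            fun i => (u.2 i).1.2) ^ 2) ∂(μ.prod (maskLaw ρ d))
          ∂((Measure.pi fun _ : Fin d => ν).prod
            (Measure.pi fun _ : Fin n => μ.prod (maskLaw ρ d))) :=
        lintegral_mono fun u => ofReal_integral_le_lintegral fun _ => sq_nonneg _
    _ = ∫⁻ w, ∫⁻ s, ∫⁻ q, ENNReal.ofReal ((q.1.2
        - zeroImpute q.2 (featureVec ψ q.1.1 w) ⬝ᵥ sgdAverage γ
          (fun i => zeroImpute (s i).2 (featureVec ψ (s i).1.1 w))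
            fun i => (s i).1.2) ^ 2) ∂(μ.prod (maskLaw ρ d))
          ∂(Measure.pi fun _ : Fin n => μ.prod (maskLaw ρ d))
          ∂(Measure.pi fun _ : Fin d => ν) :=
        lintegral_prod _ hloss.lintegral_prod_right'.aemeasurable
    _ ≤ ∫⁻ w, (ENNReal.ofReal (2 / (γ * (n + 1))
          * ((fun j => α (w j) / (ρ * d)) ⬝ᵥ fun j => α (w j) / (ρ * d)))
        + ENNReal.ofReal (1 + 3 * (γ * (d * K)))
          * ∫⁻ q, ENNReal.ofReal ((q.1.2 - zeroImpute q.2 (featureVec ψ q.1.1 w) ⬝ᵥ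
            (fun j => α (w j) / (ρ * d))) ^ 2) ∂(μ.prod (maskLaw ρ d)))
          ∂(Measure.pi fun _ : Fin d => ν) := by
        refine lintegral_mono_ae ?_
        filter_upwards [ae_zeroImpute_sq_norm_le hψ hb ρ d] with w hw
        -- The weights are frozen here, which is why the comparator may depend on them.
        refine lintegral_risk_sgdAverage_le (hx.comp measurable_prodMk_left)
          (measurable_snd.comp measurable_fst) hγ hq0 hq ?_ _
        filter_upwards [hw] with q hwq
        exact mul_le_mul_of_nonneg_left hwq hγ.le
    _ = ENNReal.ofReal (2 / (γ * (n + 1)) * ((∫ w, α w ^ 2 ∂ν) / (ρ ^ 2 * d)))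
        + ENNReal.ofReal (1 + 3 * (γ * (d * K)))
          * ∫⁻ w, ∫⁻ q, ENNReal.ofReal ((q.1.2 - zeroImpute q.2 (featureVec ψ q.1.1 w) ⬝ᵥ
            (fun j => α (w j) / (ρ * d))) ^ 2) ∂(μ.prod (maskLaw ρ d))
          ∂(Measure.pi fun _ : Fin d => ν) := by
        have hθ : Measurable fun w : Fin d → 𝒲 => fun j => α (w j) / ((ρ : ℝ) * d) := by
          fun_prop
        rw [lintegral_add_left, lintegral_sq_norm_subsampled hαm hα.1 hd (by positivity),
          lintegral_const_mul]
        · refine Measurable.lintegral_prod_right' (f := fun v : (Fin d → 𝒲) ×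
            ((𝒵 × ℝ) × (Fin d → ℝ)) => ENNReal.ofReal ((v.2.1.2 - zeroImpute v.2.2
              (featureVec ψ v.2.1.1 v.1) ⬝ᵥ (fun j => α (v.1 j) / (ρ * d))) ^ 2)) ?_
          exact ENNReal.measurable_ofReal.comp (Measurable.pow_const (Measurable.sub (by fun_prop)
            (measurable_dotProduct hx (hθ.comp measurable_fst))) 2)
        · exact ENNReal.measurable_ofReal.comp
            (measurable_const.mul (measurable_dotProduct hθ hθ))
    _ ≤ ENNReal.ofReal (2 / (γ * (n + 1)) * ((∫ w, α w ^ 2 ∂ν) / (ρ ^ 2 * d)))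
        + ENNReal.ofReal (1 + 3 * (γ * (d * K))) * (ENNReal.ofReal (latentRisk μ f)
          + ENNReal.ofReal (L ^ 2 / (ρ * d) * ∫ w, α w ^ 2 ∂ν)) := by
        refine add_le_add_right (mul_le_mul_right ?_ _) _
        refine (lintegral_risk_subsampled_le hψ hb hL hαm hα hρ hd).trans (le_of_eq ?_)
        congr 1
        exact (ofReal_integral_eq_lintegral_ofReal (hY.sub hfL).integrable_sq
          (Filter.Eventually.of_forall fun _ => sq_nonneg _)).symm
    _ = _ := by
        rw [← ENNReal.ofReal_add hR (by positivity), ← ENNReal.ofReal_mul (by positivity),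
          ← ENNReal.ofReal_add (by positivity) (by positivity)]

/-- The bound for a general step size and any one representation of the Bayes predictor; both
choices of `γ` are instances of it. -/
theorem integrable_excessRisk_and_integral_le {Ω : Type*} [MeasurableSpace Ω] {Pr : Measure Ω}
    [IsProbabilityMeasure Pr] [IsProbabilityMeasure ν] [IsProbabilityMeasure μ] {K L γ : ℝ}
    {W : Fin d → Ω → 𝒲} {Z : Fin n → Ω → 𝒵} {Y : Fin n → Ω → ℝ} {P : Fin n → Fin d → Ω → ℝ}
    (hψ : Measurable (Function.uncurry ψ)) (hS : IsMCARSample Pr ν μ ρ W Z Y P)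
    (hb : ∀ᵐ q ∂(μ.fst.prod ν), |ψ q.1 q.2| ^ 2 ≤ K)
    (hL : ∀ᵐ w ∂ν, MemLp (fun z => ψ z w) 2 μ.fst ∧ ∫ z, ψ z w ^ 2 ∂μ.fst ≤ L ^ 2)
    (hY : MemLp (fun q : 𝒵 × ℝ => q.2) 2 μ) (hf : IsBayesPredictor μ f)
    (hα : Represents ψ ν α f) (hρ : 0 < (ρ : ℝ)) (hn : 0 < n) (hd : 0 < d)
    (hγ : 0 < γ) (hK : 0 ≤ K) (hq : γ * (d * K) ≤ 1) :
    Integrable (excessRisk ψ ν μ ρ γ W Z Y P) Pr ∧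
      ∫ ω, excessRisk ψ ν μ ρ γ W Z Y P ω ∂Pr
        ≤ 4 * (L ^ 2 / (ρ * d) * (∫ w, α w ^ 2 ∂ν)
          + 1 / (γ * d * n) / ρ ^ 2 * (∫ w, α w ^ 2 ∂ν)
          + γ * (d * K) * ∫ q, q.2 ^ 2 ∂μ) := by
  obtain ⟨β, hβm, hβ, hβα⟩ := hα.exists_measurable
  rw [← hβα]
  set A := ∫ w, β w ^ 2 ∂ν with hAdef
  have hA : 0 ≤ A := integral_nonneg fun _ => sq_nonneg _
  have hR : 0 ≤ latentRisk μ f := integral_nonneg fun _ => sq_nonneg _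
  have hq0 : 0 ≤ γ * (d * K) := by positivity
  have hn' : (0 : ℝ) < n := by exact_mod_cast hn
  have hd' : (0 : ℝ) < d := by exact_mod_cast hd
  have hRb := hf.latentRisk_le_bestRiskInfty hψ hb hY ⟨β, hβ⟩
  have hRY : bestRiskInfty ψ ν μ ≤ ∫ q, q.2 ^ 2 ∂μ := bestRiskInfty_le_integral_sq
  set H : (Fin d → 𝒲) × (Fin n → (𝒵 × ℝ) × (Fin d → ℝ)) → ℝ := fun u =>
    impRisk ψ μ ρ u.1 (sgdAverage γ
      (fun i => zeroImpute (u.2 i).2 (featureVec ψ (u.2 i).1.1 u.1)) fun i => (u.2 i).1.2) with hH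
  have hxs : Measurable fun u : (Fin d → 𝒲) × (Fin n → (𝒵 × ℝ) × (Fin d → ℝ)) =>
      fun i => zeroImpute (u.2 i).2 (featureVec ψ (u.2 i).1.1 u.1) :=
    measurable_pi_lambda _ fun i =>
      measurable_zeroImpute_featureVec hψ (by fun_prop) (by fun_prop) (by fun_prop)
  have havg := measurable_sgdAverage γ hxs
    (by fun_prop : Measurable fun u : (Fin d → 𝒲) × (Fin n → (𝒵 × ℝ) × (Fin d → ℝ)) =>
      fun i => (u.2 i).1.2)
  have hHm : Measurable H := by
    refine (StronglyMeasurable.integral_prod_right' (ν := μ.prod (maskLaw ρ d))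
      (f := fun v : ((Fin d → 𝒲) × (Fin n → (𝒵 × ℝ) × (Fin d → ℝ))) ×
      ((𝒵 × ℝ) × (Fin d → ℝ)) => (v.2.1.2
        - zeroImpute v.2.2 (featureVec ψ v.2.1.1 v.1.1) ⬝ᵥ sgdAverage γ
          (fun i => zeroImpute (v.1.2 i).2 (featureVec ψ (v.1.2 i).1.1 v.1.1))
            fun i => (v.1.2 i).1.2) ^ 2) (Measurable.stronglyMeasurable ?_)).measurable
    exact Measurable.pow_const (Measurable.sub (by fun_prop)
      (measurable_dotProduct (measurable_zeroImpute_featureVec hψ (by fun_prop) (by fun_prop)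
        (by fun_prop)) (havg.comp measurable_fst))) 2
  have hbound := integrable_of_lintegral_ofReal_le (fun u => impRisk_nonneg _ _) hHm
    (by positivity) (lintegral_impRisk_sgdAverage_le (n := n) hψ hb hL hY hβm hβ hρ hd hγ hK hq)
  have hS' : HasLaw _ _ Pr := hS
  have hcomp : Integrable (H ∘ fun ω => ((fun j => W j ω),
      fun i => ((Z i ω, Y i ω), fun j => P i j ω))) Pr := by
    rw [← integrable_map_measure hHm.aestronglyMeasurable hS'.aemeasurable, hS'.map_eq]
    exact hbound.1
  have hint := hS'.integral_comp hHm.aestronglyMeasurable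
  have hex : excessRisk ψ ν μ ρ γ W Z Y P = fun ω => (H ∘ fun ω => ((fun j => W j ω),
      fun i => ((Z i ω, Y i ω), fun j => P i j ω))) ω - bestRiskInfty ψ ν μ := rfl
  rw [hex]
  refine ⟨hcomp.sub (integrable_const _), ?_⟩
  rw [integral_sub hcomp (integrable_const _), hint]
  simp only [integral_const, probReal_univ, smul_eq_mul, one_mul]
  have h1 : 2 / (γ * (n + 1)) * (A / (ρ ^ 2 * d)) ≤ 4 * (1 / (γ * d * n) / ρ ^ 2 * A) := by
    have : 2 / (γ * (n + 1)) ≤ 4 / (γ * n) :=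
      div_le_div₀ (by norm_num) (by norm_num) (by positivity) (by nlinarith)
    refine (mul_le_mul_of_nonneg_right this (by positivity)).trans (le_of_eq ?_)
    field_simp
  have h2 : 0 ≤ L ^ 2 / (ρ * d) * A := by positivity
  -- The risk of `f` enters once as `R⋆(∞)`, and its multiple by `3 * q` is absorbed through `R⋆(∞)
  -- ≤ E[Y²]`. On the approximation term `1 + 3 * q ≤ 4`.
  have h3 : (1 + 3 * (γ * (d * K))) * (latentRisk μ f + L ^ 2 / (ρ * d) * A)
      ≤ bestRiskInfty ψ ν μ + 4 * (γ * (d * K) * ∫ q, q.2 ^ 2 ∂μ)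
        + 4 * (L ^ 2 / (ρ * d) * A) := by
    have h4 := mul_le_mul_of_nonneg_left (hRb.trans hRY) hq0
    have h5 := mul_nonneg hq0 hR
    nlinarith [mul_le_mul_of_nonneg_right hq h2]
  have h6 := hbound.2
  linarith

end ExcessRisk

/-! ### Choice of the step size. -/

theorem theorem3p2 :
    ∃ C : ℝ, 0 < C ∧
      ∀ (Ω 𝒵 𝒲 : Type*) [MeasurableSpace Ω] [MeasurableSpace 𝒵] [MeasurableSpace 𝒲]
        (Pr : Measure Ω) [IsProbabilityMeasure Pr]
        (ν : Measure 𝒲) [IsProbabilityMeasure ν]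
        (μ : Measure (𝒵 × ℝ)) [IsProbabilityMeasure μ]
        (ψ : 𝒵 → 𝒲 → ℝ) (fstar : 𝒵 → ℝ) (ρ : unitInterval) (L l κ : ℝ) (n d : ℕ)
        (W : Fin d → Ω → 𝒲) (Z : Fin n → Ω → 𝒵) (Y : Fin n → Ω → ℝ)
        (P : Fin n → Fin d → Ω → ℝ),
        0 < n → 0 < d → 0 < (ρ : ℝ) → (ρ : ℝ) < 1 → 0 < L → 0 < l → 0 < κ →
        Measurable (Function.uncurry ψ) →
        IsMCARSample Pr ν μ ρ W Z Y P →
        MemLp (fun q : 𝒵 × ℝ => q.2) 2 μ →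
        (∀ᵐ z ∂μ.fst, MemLp (ψ z) 2 ν) →
        (∀ᵐ w ∂ν, MemLp (fun z => ψ z w) 2 μ.fst ∧ ∫ z, ψ z w ^ 2 ∂μ.fst ≤ L ^ 2) →
        (∀ᵐ w ∂ν, l ^ 2 ≤ ∫ z, ψ z w ^ 2 ∂μ.fst) →
        (∀ᵐ q ∂(μ.fst.prod ν), |ψ q.1 q.2| ^ 2 ≤ κ * L ^ 2) →
        IsBayesPredictor μ fstar →
        fstar ∈ featureClass ψ ν →
        (Integrable (excessRisk ψ ν μ ρ (1 / (κ * L ^ 2 * d * √n)) W Z Y P) Pr ∧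
          ∫ ω, excessRisk ψ ν μ ρ (1 / (κ * L ^ 2 * d * √n)) W Z Y P ω ∂Pr ≤
            C * (L ^ 2 / (ρ * d) * nuNormSq ψ ν fstar
              + κ * (L ^ 2 / l ^ 2) * (L ^ 2 / (ρ ^ 2 * (1 - ρ) * √n)) * nuNormSq ψ ν fstar
              + (∫ q, q.2 ^ 2 ∂μ) / √n)) ∧
        (L ^ 2 ≤ √n →
          Integrable (excessRisk ψ ν μ ρ (1 / (κ * d * √n)) W Z Y P) Pr ∧
          ∫ ω, excessRisk ψ ν μ ρ (1 / (κ * d * √n)) W Z Y P ω ∂Pr ≤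
            C * (L ^ 2 / (ρ * d) * nuNormSq ψ ν fstar
              + κ / l ^ 2 * (L ^ 2 / (ρ ^ 2 * (1 - ρ) * √n)) * nuNormSq ψ ν fstar
              + L ^ 2 * (∫ q, q.2 ^ 2 ∂μ) / √n)) := by
  refine ⟨4, by norm_num, ?_⟩
  intro Ω 𝒵 𝒲 _ _ _ Pr _ ν _ μ _ ψ fstar ρ L l κ n d W Z Y P hn hd hρ hρ1 hL hl hκ hψ hS hY
    _ hw hwl hb hBayes hmem
  have hn' : (0 : ℝ) < n := by exact_mod_cast hn
  have hd' : (0 : ℝ) < d := by exact_mod_cast hd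
  have hsn : 1 ≤ √(n : ℝ) := Real.one_le_sqrt.2 (by exact_mod_cast hn)
  have hsn0 : 0 < √(n : ℝ) := zero_lt_one.trans_le hsn
  have hρ' : 0 < 1 - (ρ : ℝ) := sub_pos.2 hρ1
  -- Both second-moment bounds hold at a common `w`, since `ν` is a probability measure.
  have hlL : l ^ 2 ≤ L ^ 2 := by
    obtain ⟨w, h1, h2⟩ := (hw.and hwl).exists
    exact h2.trans h1.2
  have hfac : 1 ≤ L ^ 2 / l ^ 2 / (1 - ρ) := by
    rw [le_div_iff₀ hρ', le_div_iff₀ (by positivity)]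
    nlinarith [ρ.2.1, sq_nonneg l]
  have key : ∀ {γ : ℝ}, 0 < γ → γ * (d * (κ * L ^ 2)) ≤ 1 →
      Integrable (excessRisk ψ ν μ ρ γ W Z Y P) Pr ∧
        ∫ ω, excessRisk ψ ν μ ρ γ W Z Y P ω ∂Pr ≤
          4 * (L ^ 2 / (ρ * d) * nuNormSq ψ ν fstar
            + 1 / (γ * d * n) / ρ ^ 2 * (L ^ 2 / l ^ 2 / (1 - ρ)) * nuNormSq ψ ν fstar
            + γ * (d * (κ * L ^ 2)) * ∫ q, q.2 ^ 2 ∂μ) := by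
    intro γ hγ hq
    have hα := fun α (hα : Represents ψ ν α fstar) =>
      integrable_excessRisk_and_integral_le hψ hS hb hw hY hBayes hα hρ hn hd hγ
        (by positivity) hq
    refine ⟨(hα _ hmem.choose_spec).1, ?_⟩
    have := le_add_mul_nuNormSq
      (b := 4 * (L ^ 2 / (ρ * d) + 1 / (γ * d * n) / ρ ^ 2 * (L ^ 2 / l ^ 2 / (1 - ρ))))
      (a := 4 * (γ * (d * (κ * L ^ 2)) * ∫ q, q.2 ^ 2 ∂μ)) (by positivity) hmem
      fun α h => (hα α h).2.trans ?_
    · linarith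
    · have hA : 0 ≤ ∫ w, α w ^ 2 ∂ν := integral_nonneg fun _ => sq_nonneg _
      have := mul_le_mul_of_nonneg_left hfac
        (by positivity : 0 ≤ 1 / (γ * d * n) / (ρ : ℝ) ^ 2 * ∫ w, α w ^ 2 ∂ν)
      linarith
  constructor
  -- This step size gives `q = 1 / √n`; the second gives `q = L² / √n`, where `L² ≤ √n` is what
  -- ensures `q ≤ 1`.
  · have hq : 1 / (κ * L ^ 2 * d * √n) * (d * (κ * L ^ 2)) = 1 / √n := by field_simp
    have hγn : 1 / (1 / (κ * L ^ 2 * d * √n) * d * n) = κ * L ^ 2 / √n := by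
      field_simp
      exact Real.sq_sqrt hn'.le
    obtain ⟨h1, h2⟩ := key (γ := 1 / (κ * L ^ 2 * d * √n)) (by positivity)
      (by rw [hq, div_le_one hsn0]; exact hsn)
    refine ⟨h1, h2.trans (le_of_eq ?_)⟩
    rw [hq, hγn]
    field_simp
  · intro hLn
    have hq : 1 / (κ * d * √n) * (d * (κ * L ^ 2)) = L ^ 2 / √n := by field_simp
    have hγn : 1 / (1 / (κ * d * √n) * d * n) = κ / √n := by
      field_simp
      exact Real.sq_sqrt hn'.le
    obtain ⟨h1, h2⟩ := key (γ := 1 / (κ * d * √n)) (by positivity)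
      (by rw [hq, div_le_one hsn0]; exact hLn)
    refine ⟨h1, h2.trans (le_of_eq ?_)⟩
    rw [hq, hγn]
    field_simp
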